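/- Work in first-order logic with primitive symbols $\bot,\wedge,\vee,\to,\forall,\exists$ (where $\neg\varphi$ is $\varphi\to\bot$); equality, if present, is treated as an ordinary relation symbol. A theory is a set of sentences. Positive formulas are those built from atomic formulas and $\bot$ by $\wedge,\vee,\exists$. Geometric implications are the positive formulas, the implications between positive formulas, and all formulas obtained from these by prefixing universal quantifiers. Ishihara's classes $\mathcal Q,\mathcal R,\mathcal J$ are defined by simultaneous induction as the least classes such that: $\mathcal Q$ contains $\bot$ and all atomic formulas, is closed under $\wedge,\vee,\exists,\forall$, and contains $J\to Q$ whenever $J\in\mathcal J$, $Q\in\mathcal Q$; $\mathcal R$ contains $\bot$, is closed under $\wedge,\vee,\forall$, and contains $J\to R$ whenever $J\in\mathcal J$, $R\in\mathcal R$; $\mathcal J$ contains $\bot$ and all atomic formulas, is closed under $\wedge,\vee,\exists$, and contains $R\to J$ whenever $R\in\mathcal R$, $J\in\mathcal J$. Derivations are tree derivations in the Gentzen–Takeuti sequent calculus (with the cut rule and the structural rules) with initial sequents $\varphi\Rightarrow\varphi$ and $\Gamma,\bot\Rightarrow\Delta$; a derivation in a theory $T$ may in addition use every sequent $\Gamma\Rightarrow\psi$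 with $\psi\in T$ as an initial sequent. A derivation is intuitionistic if every sequent in it has at most one formula in the succedent. Write $T\vdash_c\varphi$ (respectively $T\vdash_i\varphi$) if the sequent $\emptyset\Rightarrow\varphi$ has a derivation (respectively an intuitionistic derivation) in $T$. The size of a derivation is the total number of occurrences of symbols in all its sequents. **Theorem.** If $T$ is a theory all of whose axioms lie in $\mathcal Q$ and $\varphi$ is a geometric implication, then $$T\vdash_c\varphi\quad\text{implies}\quad T\vdash_i\varphi .$$ Moreover, the size increases at most polynomially: there is a polynomial $p$, independent of the language, of $T$ and of $\varphi$, such that for every (classical) derivation $\mathcal D$ of $\varphi$ in $T$ there is an intuitionistic derivation $\mathcal D'$ of $\varphi$ in $T$ with $\mathrm{size}(\mathcal D')\le p(\mathrm{size}(\mathcal D))$. -/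

import Mathlib

universe u v

namespace GeomLogic

/-! ### Formulas

First-order formulas with all connectives primitive (as needed for intuitionistic logic), over a
Mathlib first-order language `L`.  Equality is not a logical symbol; if present, it is one of the
relation symbols of `L`. -/

/-- `PreFormula L n`: formulas with free variables `a₀, a₁, a₂, …` (indexed by `ℕ`) in which, in
addition, `n` bound variables may occur that are still to be quantified.  Following Mathlib's
convention for `BoundedFormula`, a quantifier binds the last of the `n + 1` bound variables.
Negation `¬ A` is the formula `A → ⊥`. -/
inductive PreFormula (L : FirstOrder.Language.{u, v}) : ℕ → Type (max u v)
  | falsum {n : ℕ} : PreFormula L n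
  | rel {n k : ℕ} (R : L.Relations k) (ts : Fin k → L.Term (ℕ ⊕ Fin n)) : PreFormula L n
  | and {n : ℕ} (A B : PreFormula L n) : PreFormula L n
  | or {n : ℕ} (A B : PreFormula L n) : PreFormula L n
  | imp {n : ℕ} (A B : PreFormula L n) : PreFormula L n
  | all {n : ℕ} (A : PreFormula L (n + 1)) : PreFormula L n
  | ex {n : ℕ} (A : PreFormula L (n + 1)) : PreFormula L n

/-- Formulas: no dangling bound variables; free variables are allowed. -/
abbrev Formula (L : FirstOrder.Language.{u, v}) : Type (max u v) := PreFormula L 0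

variable {L : FirstOrder.Language.{u, v}}

/-- The set of free variables of a formula. -/
def PreFormula.freeVars : {n : ℕ} → PreFormula L n → Finset ℕ
  | _, .falsum => ∅
  | _, .rel _ ts => Finset.univ.biUnion fun i => (ts i).varFinsetLeft
  | _, .and A B => A.freeVars ∪ B.freeVars
  | _, .or A B => A.freeVars ∪ B.freeVars
  | _, .imp A B => A.freeVars ∪ B.freeVars
  | _, .all A => A.freeVars
  | _, .ex A => A.freeVars

/-- A sentence is a formula without free variables. -/
def IsSentence (A : Formula L) : Prop := A.freeVars = ∅

/-- Replace the outermost bound variable in a term by the term `t`. -/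
def instTerm (t : L.Term ℕ) {n : ℕ} (s : L.Term (ℕ ⊕ Fin (n + 1))) : L.Term (ℕ ⊕ Fin n) :=
  s.subst (Sum.elim (fun a => .var (.inl a))
    (Fin.cases (t.relabel Sum.inl) (fun i => .var (.inr i))))

/-- Replace the outermost bound variable in a formula by the term `t`: for `A : PreFormula L 1`,
the formula `A.inst t` is `A(t)`.  (As `t` has no bound variables, nothing can be captured.) -/
def PreFormula.inst (t : L.Term ℕ) : {n : ℕ} → PreFormula L (n + 1) → PreFormula L n
  | _, .falsum => .falsum
  | _, .rel R ts => .rel R fun i => instTerm t (ts i)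
  | _, .and A B => .and (A.inst t) (B.inst t)
  | _, .or A B => .or (A.inst t) (B.inst t)
  | _, .imp A B => .imp (A.inst t) (B.inst t)
  | _, .all A => .all (A.inst t)
  | _, .ex A => .ex (A.inst t)

/-! ### Classes of formulas -/

/-- Positive formulas: built from atomic formulas and `⊥` by `∧`, `∨`, `∃`. -/
inductive IsPositive : {n : ℕ} → PreFormula L n → Prop
  | falsum {n : ℕ} : IsPositive (.falsum : PreFormula L n)
  | rel {n k : ℕ} (R : L.Relations k) (ts : Fin k → L.Term (ℕ ⊕ Fin n)) : IsPositive (.rel R ts)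
  | and {n : ℕ} {A B : PreFormula L n} : IsPositive A → IsPositive B → IsPositive (.and A B)
  | or {n : ℕ} {A B : PreFormula L n} : IsPositive A → IsPositive B → IsPositive (.or A B)
  | ex {n : ℕ} {A : PreFormula L (n + 1)} : IsPositive A → IsPositive (.ex A)

/-- Geometric implications: positive formulas, implications between positive formulas, and
everything obtained from these by prefixing universal quantifiers. -/
inductive IsGeometricImplication : {n : ℕ} → PreFormula L n → Prop
  | pos {n : ℕ} {A : PreFormula L n} : IsPositive A → IsGeometricImplication A
  | imp {n : ℕ} {A B : PreFormula L n} :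
      IsPositive A → IsPositive B → IsGeometricImplication (.imp A B)
  | all {n : ℕ} {A : PreFormula L (n + 1)} :
      IsGeometricImplication A → IsGeometricImplication (.all A)

mutual

/-- Ishihara's class `𝒬`. -/
inductive ClassQ : {n : ℕ} → PreFormula L n → Prop
  | falsum {n : ℕ} : ClassQ (.falsum : PreFormula L n)
  | rel {n k : ℕ} (R : L.Relations k) (ts : Fin k → L.Term (ℕ ⊕ Fin n)) : ClassQ (.rel R ts)
  | and {n : ℕ} {A B : PreFormula L n} : ClassQ A → ClassQ B → ClassQ (.and A B)
  | or {n : ℕ} {A B : PreFormula L n} : ClassQ A → ClassQ B → ClassQ (.or A B)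
  | ex {n : ℕ} {A : PreFormula L (n + 1)} : ClassQ A → ClassQ (.ex A)
  | all {n : ℕ} {A : PreFormula L (n + 1)} : ClassQ A → ClassQ (.all A)
  | imp {n : ℕ} {A B : PreFormula L n} : ClassJ A → ClassQ B → ClassQ (.imp A B)

/-- Ishihara's class `ℛ`. -/
inductive ClassR : {n : ℕ} → PreFormula L n → Prop
  | falsum {n : ℕ} : ClassR (.falsum : PreFormula L n)
  | and {n : ℕ} {A B : PreFormula L n} : ClassR A → ClassR B → ClassR (.and A B)
  | or {n : ℕ} {A B : PreFormula L n} : ClassR A → ClassR B → ClassR (.or A B)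
  | all {n : ℕ} {A : PreFormula L (n + 1)} : ClassR A → ClassR (.all A)
  | imp {n : ℕ} {A B : PreFormula L n} : ClassJ A → ClassR B → ClassR (.imp A B)

/-- Ishihara's class `𝒥`. -/
inductive ClassJ : {n : ℕ} → PreFormula L n → Prop
  | falsum {n : ℕ} : ClassJ (.falsum : PreFormula L n)
  | rel {n k : ℕ} (R : L.Relations k) (ts : Fin k → L.Term (ℕ ⊕ Fin n)) : ClassJ (.rel R ts)
  | and {n : ℕ} {A B : PreFormula L n} : ClassJ A → ClassJ B → ClassJ (.and A B)
  | or {n : ℕ} {A B : PreFormula L n} : ClassJ A → ClassJ B → ClassJ (.or A B)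
  | ex {n : ℕ} {A : PreFormula L (n + 1)} : ClassJ A → ClassJ (.ex A)
  | imp {n : ℕ} {A B : PreFormula L n} : ClassR A → ClassJ B → ClassJ (.imp A B)

end

/-! ### The sequent calculus -/

/-- `a` does not occur free in any formula of the list. -/
def FreshFor (a : ℕ) (Γ : List (Formula L)) : Prop := ∀ A ∈ Γ, a ∉ A.freeVars

/-- `Derivation T Γ Δ`: derivations (as trees) of the sequent `Γ ⇒ Δ` in the Gentzen–Takeuti
sequent calculus LK with cut, with the additional initial sequents `Γ, ⊥ ⇒ Δ` and, for `A ∈ T`,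
`Γ ⇒ A`.  Antecedent and succedent are finite sequences of formulas. -/
inductive Derivation (T : Set (Formula L)) :
    List (Formula L) → List (Formula L) → Type (max u v)
  /- initial sequents -/
  | init (A : Formula L) : Derivation T [A] [A]
  | falsum (Γ Δ : List (Formula L)) : Derivation T (Γ ++ [.falsum]) Δ
  | theory (Γ : List (Formula L)) (A : Formula L) (h : A ∈ T) : Derivation T Γ [A]
  /- structural rules -/
  | weakL {Γ Δ : List (Formula L)} (A : Formula L) :
      Derivation T Γ Δ → Derivation T (A :: Γ) Δ
  | weakR {Γ Δ : List (Formula L)} (A : Formula L) :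
      Derivation T Γ Δ → Derivation T Γ (Δ ++ [A])
  | contrL {Γ Δ : List (Formula L)} {A : Formula L} :
      Derivation T (A :: A :: Γ) Δ → Derivation T (A :: Γ) Δ
  | contrR {Γ Δ : List (Formula L)} {A : Formula L} :
      Derivation T Γ (Δ ++ [A, A]) → Derivation T Γ (Δ ++ [A])
  | exchL {Γ Θ Δ : List (Formula L)} {A B : Formula L} :
      Derivation T (Γ ++ A :: B :: Θ) Δ → Derivation T (Γ ++ B :: A :: Θ) Δ
  | exchR {Γ Δ Λ : List (Formula L)} {A B : Formula L} :
      Derivation T Γ (Δ ++ A :: B :: Λ) → Derivation T Γ (Δ ++ B :: A :: Λ)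
  | cut {Γ Θ Δ Λ : List (Formula L)} {A : Formula L} :
      Derivation T Γ (Δ ++ [A]) → Derivation T (A :: Θ) Λ → Derivation T (Γ ++ Θ) (Δ ++ Λ)
  /- logical rules -/
  | andL₁ {Γ Δ : List (Formula L)} {A : Formula L} (B : Formula L) :
      Derivation T (A :: Γ) Δ → Derivation T (.and A B :: Γ) Δ
  | andL₂ {Γ Δ : List (Formula L)} (A : Formula L) {B : Formula L} :
      Derivation T (B :: Γ) Δ → Derivation T (.and A B :: Γ) Δ
  | andR {Γ Δ : List (Formula L)} {A B : Formula L} :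
      Derivation T Γ (Δ ++ [A]) → Derivation T Γ (Δ ++ [B]) → Derivation T Γ (Δ ++ [.and A B])
  | orL {Γ Δ : List (Formula L)} {A B : Formula L} :
      Derivation T (A :: Γ) Δ → Derivation T (B :: Γ) Δ → Derivation T (.or A B :: Γ) Δ
  | orR₁ {Γ Δ : List (Formula L)} {A : Formula L} (B : Formula L) :
      Derivation T Γ (Δ ++ [A]) → Derivation T Γ (Δ ++ [.or A B])
  | orR₂ {Γ Δ : List (Formula L)} (A : Formula L) {B : Formula L} :
      Derivation T Γ (Δ ++ [B]) → Derivation T Γ (Δ ++ [.or A B])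
  | impL {Γ Θ Δ Λ : List (Formula L)} {A B : Formula L} :
      Derivation T Γ (Δ ++ [A]) → Derivation T (B :: Θ) Λ →
        Derivation T (.imp A B :: (Γ ++ Θ)) (Δ ++ Λ)
  | impR {Γ Δ : List (Formula L)} {A B : Formula L} :
      Derivation T (A :: Γ) (Δ ++ [B]) → Derivation T Γ (Δ ++ [.imp A B])
  | allL {Γ Δ : List (Formula L)} {A : PreFormula L 1} (t : L.Term ℕ) :
      Derivation T (A.inst t :: Γ) Δ → Derivation T (.all A :: Γ) Δ
  | allR {Γ Δ : List (Formula L)} {A : PreFormula L 1} (a : ℕ)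
      (hΓ : FreshFor a Γ) (hΔ : FreshFor a Δ) (hA : a ∉ A.freeVars) :
      Derivation T Γ (Δ ++ [A.inst (.var a)]) → Derivation T Γ (Δ ++ [.all A])
  | exL {Γ Δ : List (Formula L)} {A : PreFormula L 1} (a : ℕ)
      (hΓ : FreshFor a Γ) (hΔ : FreshFor a Δ) (hA : a ∉ A.freeVars) :
      Derivation T (A.inst (.var a) :: Γ) Δ → Derivation T (.ex A :: Γ) Δ
  | exR {Γ Δ : List (Formula L)} {A : PreFormula L 1} (t : L.Term ℕ) :
      Derivation T Γ (Δ ++ [A.inst t]) → Derivation T Γ (Δ ++ [.ex A])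

/-- All sequents (antecedent, succedent) occurring in a derivation tree, one for each node. -/
def Derivation.sequents {T : Set (Formula L)} {Γ Δ : List (Formula L)}
    (d : Derivation T Γ Δ) : List (List (Formula L) × List (Formula L)) :=
  (Γ, Δ) :: match d with
    | .init _ => []
    | .falsum _ _ => []
    | .theory _ _ _ => []
    | .weakL _ d => d.sequents
    | .weakR _ d => d.sequents
    | .contrL d => d.sequents
    | .contrR d => d.sequents
    | .exchL d => d.sequents
    | .exchR d => d.sequents
    | .cut d e => d.sequents ++ e.sequents
    | .andL₁ _ d => d.sequents
    | .andL₂ _ d => d.sequents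
    | .andR d e => d.sequents ++ e.sequents
    | .orL d e => d.sequents ++ e.sequents
    | .orR₁ _ d => d.sequents
    | .orR₂ _ d => d.sequents
    | .impL d e => d.sequents ++ e.sequents
    | .impR d => d.sequents
    | .allL _ d => d.sequents
    | .allR _ _ _ _ d => d.sequents
    | .exL _ _ _ _ d => d.sequents
    | .exR _ d => d.sequents

/-- A derivation is intuitionistic if every sequent in it has at most one formula in the
succedent. -/
def Derivation.IsIntuitionistic {T : Set (Formula L)} {Γ Δ : List (Formula L)}
    (d : Derivation T Γ Δ) : Prop :=
  ∀ s ∈ d.sequents, s.2.length ≤ 1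

/-- `T ⊢_c A`: the sequent `∅ ⇒ A` is derivable in `T`. -/
def ProvesClassically (T : Set (Formula L)) (A : Formula L) : Prop :=
  Nonempty (Derivation T [] [A])

/-- `T ⊢_i A`: the sequent `∅ ⇒ A` has an intuitionistic derivation in `T`. -/
def ProvesIntuitionistically (T : Set (Formula L)) (A : Formula L) : Prop :=
  ∃ d : Derivation T [] [A], d.IsIntuitionistic

/-! ### Size: the number of occurrences of symbols -/

/-- Number of symbols in a term. -/
def termSize {α : Type} : L.Term α → ℕ
  | .var _ => 1
  | .func _ ts => 1 + ∑ i, termSize (ts i)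

/-- Number of symbols in a formula (a quantifier counts together with its variable). -/
def PreFormula.size : {n : ℕ} → PreFormula L n → ℕ
  | _, .falsum => 1
  | _, .rel _ ts => 1 + ∑ i, termSize (ts i)
  | _, .and A B => 1 + A.size + B.size
  | _, .or A B => 1 + A.size + B.size
  | _, .imp A B => 1 + A.size + B.size
  | _, .all A => 2 + A.size
  | _, .ex A => 2 + A.size

/-- Number of symbols in a sequent: those of its formulas, and the sequent arrow. -/
def sequentSize (s : List (Formula L) × List (Formula L)) : ℕ :=
  1 + (s.1.map PreFormula.size).sum + (s.2.map PreFormula.size).sum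

/-- The size of a derivation: the total number of symbols in all its sequents. -/
def Derivation.size {T : Set (Formula L)} {Γ Δ : List (Formula L)}
    (d : Derivation T Γ Δ) : ℕ :=
  (d.sequents.map sequentSize).sum

end GeomLogic

/-! Classical derivations of geometric implications from axioms in Ishihara's class `𝒬` are turned
into intuitionistic ones by a negative translation of linear size. -/

-- Fix a formula s in the role of falsity and write ∼A for A → s. The formula `refut s A` expresses
-- a refutation of A, and ∼`refut s A` is a negative translation of A. Only ∃ gets an explicit
-- double negation: its refutation is a ∀, and ∀ does not commute with ∼∼ intuitionistically,
-- whereas ∧, the refutation of ∨, does. A classical derivation of Γ ⇒ Δ then becomes a derivation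
-- of s from ∼`refut s A` for A in Γ and `refut s B` for B in Δ (`Derivation.toIntDer`). Each
-- logical rule costs a bounded number of steps, since case distinctions on X versus ∼X are harmless
-- while the goal is s.
--
-- It remains to compare a formula with its translation (`classes_refut`). For A in 𝒬, A and its
-- refutation yield s, so the axioms entail their translations. For A in 𝒥, the translation yields
-- ∼∼A. For A in ℛ, the refutation yields ∼∼(A → ⊥) with the genuine ⊥. This is what implications R
-- → J need, because R → J follows from R → ⊥ but not from R → s; it also explains why atoms are not
-- in ℛ.
--
-- Finally s is chosen as in Friedman's trick. If B is positive and s = B, then ∼B is provable and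
-- the 𝒥 property returns B itself; a positive premise A is handled by its 𝒬 property
-- (`IsGeometricImplication.intDer`). Leading quantifiers ∀ are stripped before s is chosen, so s
-- may contain their eigenvariables. The translation is therefore proved for every s, with
-- eigenvariables renamed on the way.
--
-- For the size: with N the size of the classical derivation, translated formulas have size O(N²),
-- and the number of steps in `IntDer` is O(N). Each step adds at most one size bound to the
-- context, so sequents have size O(N³), and restoring the structural rules costs a cubic factor per
-- step (`IntDer.intDerivable`).

namespace GeomLogic

variable {L : FirstOrder.Language.{u, v}}

/-! ### Renaming of free variables, weakening of the bound context -/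

/-- Rename the free variables of a formula. -/
def PreFormula.rename (σ : ℕ → ℕ) : {n : ℕ} → PreFormula L n → PreFormula L n
  | _, .falsum => .falsum
  | _, .rel R ts => .rel R fun i => (ts i).relabel (Sum.map σ id)
  | _, .and A B => .and (A.rename σ) (B.rename σ)
  | _, .or A B => .or (A.rename σ) (B.rename σ)
  | _, .imp A B => .imp (A.rename σ) (B.rename σ)
  | _, .all A => .all (A.rename σ)
  | _, .ex A => .ex (A.rename σ)

/-- Insert a new outermost bound variable that does not occur. -/
def PreFormula.lift : {n : ℕ} → PreFormula L n → PreFormula L (n + 1)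
  | _, .falsum => .falsum
  | _, .rel R ts => .rel R fun i => (ts i).relabel (Sum.map id Fin.succ)
  | _, .and A B => .and A.lift B.lift
  | _, .or A B => .or A.lift B.lift
  | _, .imp A B => .imp A.lift B.lift
  | _, .all A => .all A.lift
  | _, .ex A => .ex A.lift

/-- A formula regarded as a formula in which `n` bound variables may occur. -/
def PreFormula.liftTo (A : Formula L) : (n : ℕ) → PreFormula L n
  | 0 => A
  | n + 1 => (A.liftTo n).lift

theorem termSize_relabel {α β : Type} (f : α → β) (t : L.Term α) :
    termSize (t.relabel f) = termSize t := by
  induction t with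
  | var => rfl
  | func F ts ih => simp [FirstOrder.Language.Term.relabel, termSize, ih]

theorem PreFormula.size_rename (σ : ℕ → ℕ) {n : ℕ} (A : PreFormula L n) :
    (A.rename σ).size = A.size := by
  induction A <;> simp_all [rename, size, termSize_relabel]

theorem PreFormula.size_lift {n : ℕ} (A : PreFormula L n) : A.lift.size = A.size := by
  induction A <;> simp_all [lift, size, termSize_relabel]

theorem PreFormula.size_liftTo (A : Formula L) (n : ℕ) : (A.liftTo n).size = A.size := by
  induction n with
  | zero => rfl
  | succ n ih => rw [liftTo, size_lift, ih]

theorem PreFormula.size_pos {n : ℕ} (A : PreFormula L n) : 0 < A.size := by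
  cases A <;> simp only [size] <;> omega

theorem termSize_instTerm_var (a : ℕ) {n : ℕ} (s : L.Term (ℕ ⊕ Fin (n + 1))) :
    termSize (instTerm (.var a) s) = termSize s := by
  induction s with
  | var x =>
    rcases x with x | x
    · rfl
    · cases x using Fin.cases <;> rfl
  | func F ts ih =>
    simp only [instTerm, FirstOrder.Language.Term.relabel] at ih
    simp [instTerm, FirstOrder.Language.Term.subst, termSize, ih]

/-- Induction for formulas with at least one pending bound variable. -/
theorem PreFormula.succ_induction {motive : (n : ℕ) → PreFormula L (n + 1) → Prop}
    (falsum : ∀ n, motive n .falsum)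
    (rel : ∀ n k (R : L.Relations k) ts, motive n (.rel R ts))
    (and : ∀ n A B, motive n A → motive n B → motive n (.and A B))
    (or : ∀ n A B, motive n A → motive n B → motive n (.or A B))
    (imp : ∀ n A B, motive n A → motive n B → motive n (.imp A B))
    (all : ∀ n A, motive (n + 1) A → motive n (.all A))
    (ex : ∀ n A, motive (n + 1) A → motive n (.ex A))
    {n : ℕ} (B : PreFormula L (n + 1)) : motive n B := by
  -- The index becomes a variable `m` with an equation, so that ordinary induction on the formula
  -- applies.
  suffices ∀ m (A : PreFormula L m) (h : m = n + 1), motive n (h ▸ A) from this _ B rfl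
  clear B
  intro m A
  induction A generalizing n with
  | falsum => rintro rfl; exact falsum _
  | rel R ts => rintro rfl; exact rel _ _ R ts
  | and A B ihA ihB => rintro rfl; exact and _ _ _ (ihA rfl) (ihB rfl)
  | or A B ihA ihB => rintro rfl; exact or _ _ _ (ihA rfl) (ihB rfl)
  | imp A B ihA ihB => rintro rfl; exact imp _ _ _ (ihA rfl) (ihB rfl)
  | all A ih => rintro rfl; exact all _ _ (ih rfl)
  | ex A ih => rintro rfl; exact ex _ _ (ih rfl)

theorem PreFormula.size_inst_var (a : ℕ) {n : ℕ} (A : PreFormula L (n + 1)) :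
    (A.inst (.var a)).size = A.size := by
  induction A using PreFormula.succ_induction <;> simp_all [inst, size, termSize_instTerm_var]

theorem instTerm_relabel_succ (t : L.Term ℕ) {n : ℕ} (s : L.Term (ℕ ⊕ Fin n)) :
    instTerm t (s.relabel (Sum.map id Fin.succ)) = s := by
  induction s with
  | var x => rcases x with x | x <;> rfl
  | func F ts ih =>
    simp only [instTerm] at ih
    simp [instTerm, FirstOrder.Language.Term.relabel, FirstOrder.Language.Term.subst, ih]

theorem PreFormula.inst_lift (t : L.Term ℕ) {n : ℕ} (A : PreFormula L n) :
    A.lift.inst t = A := by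
  induction A <;> simp_all [lift, inst, instTerm_relabel_succ]

theorem relabel_instTerm (σ : ℕ → ℕ) (t : L.Term ℕ) {n : ℕ} (s : L.Term (ℕ ⊕ Fin (n + 1))) :
    (instTerm t s).relabel (Sum.map σ id) =
      instTerm (t.relabel σ) (s.relabel (Sum.map σ id)) := by
  induction s with
  | var x =>
    rcases x with x | x
    · rfl
    · cases x using Fin.cases with
      | zero =>
        change (t.relabel Sum.inl).relabel _ = (t.relabel σ).relabel Sum.inl
        simp only [FirstOrder.Language.Term.relabel_relabel]
        rfl
      | succ i => rfl
  | func F ts ih =>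
    simp only [instTerm] at ih
    simp [instTerm, FirstOrder.Language.Term.relabel, FirstOrder.Language.Term.subst, ih]

theorem PreFormula.rename_inst (σ : ℕ → ℕ) (t : L.Term ℕ) {n : ℕ} (A : PreFormula L (n + 1)) :
    (A.inst t).rename σ = (A.rename σ).inst (t.relabel σ) := by
  induction A using PreFormula.succ_induction <;> simp_all [inst, rename, relabel_instTerm]

theorem relabel_congr_varFinsetLeft {σ τ : ℕ → ℕ} {β : Type} (t : L.Term (ℕ ⊕ β))
    (h : ∀ a ∈ t.varFinsetLeft, σ a = τ a) :
    t.relabel (Sum.map σ id) = t.relabel (Sum.map τ id) := by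
  induction t with
  | var x =>
    rcases x with x | x
    · simpa [FirstOrder.Language.Term.varFinsetLeft, FirstOrder.Language.Term.relabel] using h
    · rfl
  | func F ts ih =>
    simp only [FirstOrder.Language.Term.varFinsetLeft, Finset.mem_biUnion, Finset.mem_univ,
      true_and, forall_exists_index] at h
    simp only [FirstOrder.Language.Term.relabel, FirstOrder.Language.Term.func.injEq, heq_eq_eq,
      true_and]
    exact funext fun i => ih i fun a ha => h a i ha

theorem PreFormula.rename_congr {σ τ : ℕ → ℕ} {n : ℕ} (A : PreFormula L n)
    (h : ∀ a ∈ A.freeVars, σ a = τ a) : A.rename σ = A.rename τ := by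
  induction A with
  | falsum => rfl
  | rel R ts =>
    simp only [freeVars, Finset.mem_biUnion, Finset.mem_univ, true_and, forall_exists_index] at h
    simp only [rename, rel.injEq, heq_eq_eq, true_and]
    exact funext fun i => relabel_congr_varFinsetLeft _ fun a ha => h a i ha
  | and A B ihA ihB | or A B ihA ihB | imp A B ihA ihB =>
    simp only [freeVars, Finset.mem_union] at h
    simp only [rename, ihA fun a ha => h a (.inl ha), ihB fun a ha => h a (.inr ha)]
  | all A ih | ex A ih =>
    simp only [freeVars] at h
    simp only [rename, ih h]

theorem PreFormula.rename_id {n : ℕ} (A : PreFormula L n) : A.rename id = A := by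
  induction A <;> simp_all [rename]

/-- The translation renames free variables throughout; axioms survive this because they are closed.
-/
theorem IsSentence.rename_eq {A : Formula L} (h : IsSentence A) (σ : ℕ → ℕ) :
    A.rename σ = A := by
  rw [A.rename_congr (τ := id), A.rename_id]
  simp [show A.freeVars = ∅ from h]

/-- Every finite list of formulas admits a fresh variable. -/
theorem exists_freshFor (Γ : List (Formula L)) : ∃ a, FreshFor a Γ := by
  classical
  obtain ⟨a, ha⟩ := Infinite.exists_notMem_finset (Γ.toFinset.biUnion PreFormula.freeVars)
  refine ⟨a, fun A hA h => ha ?_⟩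
  simp only [Finset.mem_biUnion]
  exact ⟨A, by simpa using hA, h⟩

/-- Together with `rename_update_inst`, this replaces the eigenvariable `a` of a quantifier rule by
a fresh `b`: the side formulas do not notice the update of `σ`, and the active formula becomes the
instance at `b`. -/
theorem rename_update_of_fresh {a : ℕ} {Γ : List (Formula L)} (h : FreshFor a Γ) (σ : ℕ → ℕ)
    (b : ℕ) {A : Formula L} (hA : A ∈ Γ) : A.rename (Function.update σ a b) = A.rename σ :=
  A.rename_congr fun _ hc => Function.update_of_ne (by rintro rfl; exact h A hA hc) _ _

theorem rename_update_inst {a : ℕ} {A : PreFormula L 1} (h : a ∉ A.freeVars) (σ : ℕ → ℕ)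
    (b : ℕ) : (A.inst (.var a)).rename (Function.update σ a b) =
      (A.rename σ).inst (.var b) := by
  rw [PreFormula.rename_inst, A.rename_congr (τ := σ) fun _ hc =>
    Function.update_of_ne (by rintro rfl; exact h hc) _ _]
  simp [FirstOrder.Language.Term.relabel]

/-! ### The classes of formulas are closed under instantiation -/

theorem IsPositive.inst (t : L.Term ℕ) {n : ℕ} {A : PreFormula L (n + 1)} (h : IsPositive A) :
    IsPositive (A.inst t) := by
  induction A using PreFormula.succ_induction with
  | falsum | rel => rw [PreFormula.inst]; constructor
  | and _ _ _ ihA ihB =>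
    rw [PreFormula.inst]; cases h with | and hA hB => exact .and (ihA hA) (ihB hB)
  | or _ _ _ ihA ihB =>
    rw [PreFormula.inst]; cases h with | or hA hB => exact .or (ihA hA) (ihB hB)
  | imp | all => cases h
  | ex _ _ ih => rw [PreFormula.inst]; cases h with | ex hA => exact .ex (ih hA)

theorem IsGeometricImplication.inst (t : L.Term ℕ) {n : ℕ} {A : PreFormula L (n + 1)}
    (h : IsGeometricImplication A) : IsGeometricImplication (A.inst t) := by
  induction A using PreFormula.succ_induction with
  | imp =>
    rw [PreFormula.inst]
    cases h with
    | pos h => cases h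
    | imp hA hB => exact .imp (hA.inst t) (hB.inst t)
  | all _ _ ih =>
    rw [PreFormula.inst]
    cases h with
    | pos h => cases h
    | all h => exact .all (ih h)
  | _ => cases h with | pos h => exact .pos (h.inst t)

theorem classes_inst (t : L.Term ℕ) {n : ℕ} (A : PreFormula L (n + 1)) :
    (ClassQ A → ClassQ (A.inst t)) ∧ (ClassR A → ClassR (A.inst t)) ∧
      (ClassJ A → ClassJ (A.inst t)) := by
  induction A using PreFormula.succ_induction with
  | falsum => rw [PreFormula.inst]; exact ⟨fun _ => .falsum, fun _ => .falsum, fun _ => .falsum⟩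
  | rel => rw [PreFormula.inst]; exact ⟨fun _ => .rel _ _, nofun, fun _ => .rel _ _⟩
  | and _ _ _ ihA ihB =>
    rw [PreFormula.inst]
    exact ⟨fun | .and hA hB => .and (ihA.1 hA) (ihB.1 hB),
      fun | .and hA hB => .and (ihA.2.1 hA) (ihB.2.1 hB),
      fun | .and hA hB => .and (ihA.2.2 hA) (ihB.2.2 hB)⟩
  | or _ _ _ ihA ihB =>
    rw [PreFormula.inst]
    exact ⟨fun | .or hA hB => .or (ihA.1 hA) (ihB.1 hB),
      fun | .or hA hB => .or (ihA.2.1 hA) (ihB.2.1 hB),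
      fun | .or hA hB => .or (ihA.2.2 hA) (ihB.2.2 hB)⟩
  | imp _ _ _ ihA ihB =>
    rw [PreFormula.inst]
    exact ⟨fun | .imp hA hB => .imp (ihA.2.2 hA) (ihB.1 hB),
      fun | .imp hA hB => .imp (ihA.2.2 hA) (ihB.2.1 hB),
      fun | .imp hA hB => .imp (ihA.2.1 hA) (ihB.2.2 hB)⟩
  | all _ _ ih =>
    rw [PreFormula.inst]
    exact ⟨fun | .all h => .all (ih.1 h), fun | .all h => .all (ih.2.1 h), nofun⟩
  | ex _ _ ih =>
    rw [PreFormula.inst]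
    exact ⟨fun | .ex h => .ex (ih.1 h), nofun, fun | .ex h => .ex (ih.2.2 h)⟩

/-- The 𝒬 property serves the premise of a geometric implication, the 𝒥 property of
`IsPositive.classJ` its conclusion. -/
theorem IsPositive.classQ {n : ℕ} {A : PreFormula L n} (h : IsPositive A) : ClassQ A := by
  induction h with
  | falsum => exact .falsum
  | rel => exact .rel _ _
  | and _ _ ihA ihB => exact .and ihA ihB
  | or _ _ ihA ihB => exact .or ihA ihB
  | ex _ ih => exact .ex ih

theorem IsPositive.classJ {n : ℕ} {A : PreFormula L n} (h : IsPositive A) : ClassJ A := by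
  induction h with
  | falsum => exact .falsum
  | rel => exact .rel _ _
  | and _ _ ihA ihB => exact .and ihA ihB
  | or _ _ ihA ihB => exact .or ihA ihB
  | ex _ ih => exact .ex ih

/-! ### The refutation translation -/

/-- `refut s A` says, relative to the formula `s` in the role of falsity, that `A` is refuted:
`refut s A → s` is a negative translation of `A`. -/
def refut (s : Formula L) : {n : ℕ} → PreFormula L n → PreFormula L n
  | _, .falsum => .imp .falsum .falsum
  | n, .rel R ts => .imp (.rel R ts) (s.liftTo n)
  | _, .and A B => .or (refut s A) (refut s B)
  | _, .or A B => .and (refut s A) (refut s B)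
  | n, .imp A B => .and (.imp (refut s A) (s.liftTo n)) (refut s B)
  | _, .all A => .ex (refut s A)
  | n, .ex A => .all (.imp (.imp (refut s A) (s.liftTo (n + 1))) (s.liftTo (n + 1)))

/-- The copies of `s` are lifted, hence contain no bound variable that the instantiation could
touch. -/
theorem refut_inst (s : Formula L) (t : L.Term ℕ) {n : ℕ} (A : PreFormula L (n + 1)) :
    (refut s A).inst t = refut s (A.inst t) := by
  induction A using PreFormula.succ_induction <;>
    simp_all [PreFormula.inst, refut, PreFormula.liftTo, PreFormula.inst_lift]

/-- No clause inserts more than two copies of `s` and a few connectives, so the cost per symbol of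
`A` is at most `2 * s.size + 4`. -/
theorem size_refut_le (s : Formula L) {n : ℕ} (A : PreFormula L n) :
    (refut s A).size ≤ (2 * s.size + 4) * A.size := by
  induction A with
  | falsum => simp only [refut, PreFormula.size]; omega
  | rel R ts =>
    simp only [refut, PreFormula.size, PreFormula.size_liftTo]
    generalize ∑ i, termSize (ts i) = m
    have := s.size.zero_le
    nlinarith [Nat.zero_le (s.size * m)]
  | _ => simp only [refut, PreFormula.size, PreFormula.size_liftTo]; nlinarith

/-! ### A cumulative intuitionistic calculus -/

/-- `IntDer T M n Γ C`: the sequent `Γ ⇒ C` has an intuitionistic derivation with at most `n`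
rule applications in a cumulative (G3-style) calculus with cut, in which the formulas introduced
by cuts and instantiations have size at most `M`, unless they are already as large as an instance
at a variable. -/
inductive IntDer (T : Set (Formula L)) (M : ℕ) : ℕ → List (Formula L) → Formula L → Prop
  | mono {m n : ℕ} {Γ : List (Formula L)} {C : Formula L} :
      IntDer T M m Γ C → m ≤ n → IntDer T M n Γ C
  | ax {Γ : List (Formula L)} {C : Formula L} : C ∈ Γ → IntDer T M 1 Γ C
  | theory {Γ : List (Formula L)} {A : Formula L} : A ∈ T → IntDer T M 1 Γ A
  | falsum {Γ : List (Formula L)} {C : Formula L} : .falsum ∈ Γ → IntDer T M 1 Γ C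
  | cut {m n : ℕ} {Γ : List (Formula L)} {C : Formula L} (A : Formula L) : A.size ≤ M →
      IntDer T M m Γ A → IntDer T M n (A :: Γ) C → IntDer T M (m + n + 1) Γ C
  | andL {n : ℕ} {Γ : List (Formula L)} {A B C : Formula L} : .and A B ∈ Γ →
      IntDer T M n (A :: B :: Γ) C → IntDer T M (n + 1) Γ C
  | andR {m n : ℕ} {Γ : List (Formula L)} {A B : Formula L} :
      IntDer T M m Γ A → IntDer T M n Γ B → IntDer T M (m + n + 1) Γ (.and A B)
  | orL {m n : ℕ} {Γ : List (Formula L)} {A B C : Formula L} : .or A B ∈ Γ →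
      IntDer T M m (A :: Γ) C → IntDer T M n (B :: Γ) C → IntDer T M (m + n + 1) Γ C
  | orR₁ {n : ℕ} {Γ : List (Formula L)} {A B : Formula L} :
      IntDer T M n Γ A → IntDer T M (n + 1) Γ (.or A B)
  | orR₂ {n : ℕ} {Γ : List (Formula L)} {A B : Formula L} :
      IntDer T M n Γ B → IntDer T M (n + 1) Γ (.or A B)
  | impL {m n : ℕ} {Γ : List (Formula L)} {A B C : Formula L} : .imp A B ∈ Γ →
      IntDer T M m Γ A → IntDer T M n (B :: Γ) C → IntDer T M (m + n + 1) Γ C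
  | impR {n : ℕ} {Γ : List (Formula L)} {A B : Formula L} :
      IntDer T M n (A :: Γ) B → IntDer T M (n + 1) Γ (.imp A B)
  | allL {n : ℕ} {Γ : List (Formula L)} {A : PreFormula L 1} {C : Formula L} (t : L.Term ℕ) :
      .all A ∈ Γ → (A.inst t).size ≤ max A.size M →
      IntDer T M n (A.inst t :: Γ) C → IntDer T M (n + 1) Γ C
  | allR {n : ℕ} {Γ : List (Formula L)} {A : PreFormula L 1} (a : ℕ) :
      FreshFor a (.all A :: Γ) → IntDer T M n Γ (A.inst (.var a)) → IntDer T M (n + 1) Γ (.all A)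
  | exL {n : ℕ} {Γ : List (Formula L)} {A : PreFormula L 1} {C : Formula L} (a : ℕ) :
      .ex A ∈ Γ → FreshFor a (C :: Γ) →
      IntDer T M n (A.inst (.var a) :: Γ) C → IntDer T M (n + 1) Γ C
  | exR {n : ℕ} {Γ : List (Formula L)} {A : PreFormula L 1} (t : L.Term ℕ) :
      (A.inst t).size ≤ max A.size M →
      IntDer T M n Γ (A.inst t) → IntDer T M (n + 1) Γ (.ex A)

namespace IntDer

variable {T : Set (Formula L)} {M n : ℕ} {Γ : List (Formula L)} {A : PreFormula L 1}
  {X Y C s : Formula L}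

theorem impL' (h : .imp X C ∈ Γ) (d : IntDer T M n Γ X) : IntDer T M (n + 2) Γ C :=
  .impL h d (.ax (.head _))

theorem allL_var (a : ℕ) (h : .all A ∈ Γ) (d : IntDer T M n (A.inst (.var a) :: Γ) C) :
    IntDer T M (n + 1) Γ C :=
  .allL _ h ((PreFormula.size_inst_var a A).trans_le (le_max_left _ _)) d

theorem exR_var (a : ℕ) (d : IntDer T M n Γ (A.inst (.var a))) : IntDer T M (n + 1) Γ (.ex A) :=
  .exR _ ((PreFormula.size_inst_var a A).trans_le (le_max_left _ _)) d

/-- Case distinction on `X`, available because the goal is `s`: the branch assuming `X` proves `X →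
s`, on which the other branch is cut. -/
theorem cutNeg {m : ℕ} (X : Formula L) (hX : (X.imp s).size ≤ M) (d : IntDer T M m (X :: Γ) s)
    (e : IntDer T M n (.imp X s :: Γ) s) : IntDer T M (m + 1 + n + 1) Γ s :=
  .cut _ hX (.impR d) e

theorem negL (h : .imp X .falsum ∈ Γ) (h' : X ∈ Γ) : IntDer T M 3 Γ C :=
  .impL h (.ax h') (.falsum (.head _))

end IntDer

-- Ishihara's classes and the refutation translation

theorem doubleNeg_refut_inst (s : Formula L) (t : L.Term ℕ) (A : PreFormula L 1) :
    (PreFormula.imp (.imp (refut s A) (s.liftTo 1)) (s.liftTo 1)).inst t =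
      .imp (.imp (refut s (A.inst t)) s) s := by
  simp only [PreFormula.inst, PreFormula.liftTo, PreFormula.inst_lift, refut_inst]

/-- Ishihara's classes relate a formula to its refutation translation. -/
theorem classes_refut (T : Set (Formula L)) (M : ℕ) (s : Formula L) (k : ℕ) :
    (∀ A : Formula L, A.size ≤ k → (refut s A).size + A.size + s.size + 4 ≤ M) →
    ∀ A : Formula L, A.size ≤ k → ∀ Γ : List (Formula L),
      (ClassQ A → A ∈ Γ → refut s A ∈ Γ → IntDer T M (40 * A.size) Γ s) ∧
      (ClassJ A → .imp (refut s A) s ∈ Γ → .imp A s ∈ Γ → IntDer T M (40 * A.size) Γ s) ∧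
      (ClassR A → .imp (.imp A .falsum) s ∈ Γ → refut s A ∈ Γ →
        IntDer T M (40 * A.size) Γ s) := by
  -- The induction is on size, because the quantifier cases pass to `A.inst (.var a)`, which is
  -- smaller than the quantified formula but not a subformula.
  induction k with
  | zero => exact fun _ A hA => absurd A.size_pos (by omega)
  | succ k ih =>
  intro hM A hk Γ
  replace ih := ih fun A hA => hM A (by omega)
  have Q (B : Formula L) (hB : B.size < A.size) (hQ : ClassQ B) {Γ : List (Formula L)} :=
    (ih B (by omega) Γ).1 hQ
  have J (B : Formula L) (hB : B.size < A.size) (hJ : ClassJ B) {Γ : List (Formula L)} :=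
    (ih B (by omega) Γ).2.1 hJ
  have R (B : Formula L) (hB : B.size < A.size) (hR : ClassR B) {Γ : List (Formula L)} :=
    (ih B (by omega) Γ).2.2 hR
  have cX (B : Formula L) (hB : B.size < A.size) : (B.imp s).size ≤ M := by
    have := hM B (by omega)
    simp only [PreFormula.size]; omega
  have cR (B : Formula L) (hB : B.size < A.size) : ((refut s B).imp s).size ≤ M := by
    have := hM B (by omega)
    simp only [PreFormula.size]; omega
  have cN (B : Formula L) (hB : B.size < A.size) :
      ((B.imp .falsum).imp s).size ≤ M := by
    have := hM B (by omega)
    simp only [PreFormula.size]; omega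
  clear ih hM
  refine ⟨fun hC h₁ h₂ => ?_, fun hC h₁ h₂ => ?_, fun hC h₁ h₂ => ?_⟩
  · cases hC with
    | falsum => exact (IntDer.falsum h₁).mono (by simp [PreFormula.size])
    | rel P ts =>
      exact (IntDer.impL' h₂ (.ax h₁)).mono (by simp only [PreFormula.size]; omega)
    | @and _ A B hA hB =>
      simp only [PreFormula.size, refut] at *
      exact IntDer.mono (.andL h₁ (.orL (A := refut s A) (B := refut s B) (by simp [h₂])
        (Q A (by omega) hA (by simp) (by simp)) (Q B (by omega) hB (by simp) (by simp))))
        (by omega)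
    | @or _ A B hA hB =>
      simp only [PreFormula.size, refut] at *
      exact IntDer.mono (.andL h₂ (.orL (A := A) (B := B) (by simp [h₁])
        (Q A (by omega) hA (by simp) (by simp)) (Q B (by omega) hB (by simp) (by simp))))
        (by omega)
    | @ex _ A hA =>
      simp only [PreFormula.size, refut] at *
      obtain ⟨a, ha⟩ := exists_freshFor (s :: Γ)
      have hs := A.size_inst_var a
      have d := Q (A.inst (.var a)) (by omega) ((classes_inst _ A).1 hA)
        (Γ := refut s (A.inst (.var a)) :: .imp (.imp (refut s (A.inst (.var a))) s) s ::
          A.inst (.var a) :: Γ) (by simp) (by simp)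
      have e := IntDer.impL' (.head _) (.impR d)
      rw [← doubleNeg_refut_inst] at e
      exact IntDer.mono (.exL a h₁ ha (.allL_var a (.tail _ h₂) e)) (by omega)
    | @all _ A hA =>
      simp only [PreFormula.size, refut] at *
      obtain ⟨a, ha⟩ := exists_freshFor (s :: Γ)
      have hs := A.size_inst_var a
      exact IntDer.mono (.exL a h₂ ha (.allL_var a (.tail _ h₁)
        (Q (A.inst (.var a)) (by omega) ((classes_inst _ A).1 hA) (by simp)
          (by simp [refut_inst])))) (by omega)
    | @imp _ A B hA hB =>
      simp only [PreFormula.size, refut, PreFormula.liftTo] at *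
      -- If `A` holds, so does `B`, against its refutation. If `A → s` holds, it clashes with `refut
      -- s A → s`, as `A` is in 𝒥.
      exact IntDer.mono (.andL h₂ (.cutNeg A (cX A (by omega))
        (.impL (A := A) (B := B) (by simp [h₁]) (.ax (.head _))
          (Q B (by omega) hB (by simp) (by simp)))
        (J A (by omega) hA (by simp) (by simp)))) (by omega)
  · cases hC with
    | falsum =>
      exact (IntDer.impL' h₁ (.impR (.ax (.head _)))).mono (by simp only [PreFormula.size]; omega)
    | rel P ts =>
      exact (IntDer.impL' h₁ (.ax h₂)).mono (by simp only [PreFormula.size]; omega)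
    | @and _ A B hA hB =>
      simp only [PreFormula.size, refut] at *
      exact IntDer.mono (.cutNeg (refut s A) (cR A (by omega))
        (.impL' (.tail _ h₁) (.orR₁ (.ax (.head _))))
        (.cutNeg (refut s B) (cR B (by omega))
          (.impL' (.tail _ (.tail _ h₁)) (.orR₂ (.ax (.head _))))
          (.cutNeg A (cX A (by omega))
            (.cutNeg B (cX B (by omega))
              (.impL' (X := .and A B) (by simp [h₂]) (.andR (.ax (by simp)) (.ax (by simp))))
              (J B (by omega) hB (by simp) (by simp)))
            (J A (by omega) hA (by simp) (by simp))))) (by omega)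
    | @or _ A B hA hB =>
      simp only [PreFormula.size, refut] at *
      exact IntDer.mono (.cutNeg A (cX A (by omega))
        (.impL' (.tail _ h₂) (.orR₁ (.ax (.head _))))
        (.cutNeg B (cX B (by omega))
          (.impL' (.tail _ (.tail _ h₂)) (.orR₂ (.ax (.head _))))
          (.cutNeg (refut s A) (cR A (by omega))
            (.cutNeg (refut s B) (cR B (by omega))
              (.impL' (X := .and (refut s A) (refut s B)) (by simp [h₁])
                (.andR (.ax (by simp)) (.ax (by simp))))
              (J B (by omega) hB (by simp) (by simp)))
            (J A (by omega) hA (by simp) (by simp))))) (by omega)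
    | @ex _ A hA =>
      simp only [PreFormula.size] at *
      obtain ⟨a, ha⟩ := exists_freshFor (refut s (.ex A) :: Γ)
      have hs := A.size_inst_var a
      have d := IntDer.impR (T := T) (M := M) (Γ := Γ) (B := s)
        (A := .imp (refut s (A.inst (.var a))) s)
        (.cutNeg (A.inst (.var a)) (cX (A.inst (.var a)) (by omega))
          (.impL' (X := .ex A) (by simp [h₂]) (.exR_var a (.ax (.head _))))
          (J (A.inst (.var a)) (by omega) ((classes_inst _ A).2.2 hA) (by simp) (by simp)))
      simp only [refut] at h₁ ha
      rw [← doubleNeg_refut_inst] at d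
      exact IntDer.mono (.impL' h₁ (.allR a ha d)) (by omega)
    | @imp _ A B hA hB =>
      simp only [PreFormula.size, refut, PreFormula.liftTo] at *
      -- Inside the first branch, `refut s A → s` is proved by distinguishing cases on the genuine
      -- negation `A → ⊥`, which gives `A → B` ex falso; the other case is the ℛ property of `A`.
      exact IntDer.mono (.cutNeg (refut s B) (cR B (by omega))
        (.impL' (.tail _ h₁) (.andR
          (.impR (.cutNeg (.imp A .falsum) (cN A (by omega))
            (.impL' (X := .imp A B) (by simp [h₂])
              (.impR (.negL (X := A) (by simp) (by simp))))
            (R A (by omega) hA (by simp) (by simp))))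
          (.ax (.head _))))
        (.cutNeg B (cX B (by omega))
          (.impL' (X := .imp A B) (by simp [h₂]) (.impR (.ax (by simp))))
          (J B (by omega) hB (by simp) (by simp)))) (by omega)
  · cases hC with
    | falsum =>
      exact (IntDer.impL' h₁ (.impR (.ax (.head _)))).mono (by simp only [PreFormula.size]; omega)
    | @and _ A B hA hB =>
      simp only [PreFormula.size, refut] at *
      exact IntDer.mono (.orL h₂
        (.cutNeg (.imp A .falsum) (cN A (by omega))
          (.impL' (X := .imp (.and A B) .falsum) (by simp [h₁])
            (.impR (.andL (.head _) (.negL (X := A) (by simp) (by simp)))))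
          (R A (by omega) hA (by simp) (by simp)))
        (.cutNeg (.imp B .falsum) (cN B (by omega))
          (.impL' (X := .imp (.and A B) .falsum) (by simp [h₁])
            (.impR (.andL (.head _) (.negL (X := B) (by simp) (by simp)))))
          (R B (by omega) hB (by simp) (by simp)))) (by omega)
    | @or _ A B hA hB =>
      simp only [PreFormula.size, refut] at *
      exact IntDer.mono (.andL h₂
        (.cutNeg (.imp A .falsum) (cN A (by omega))
          (.cutNeg (.imp B .falsum) (cN B (by omega))
            (.impL' (X := .imp (.or A B) .falsum) (by simp [h₁])
              (.impR (.orL (.head _) (.negL (X := A) (by simp) (by simp))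
                (.negL (X := B) (by simp) (by simp)))))
            (R B (by omega) hB (by simp) (by simp)))
          (R A (by omega) hA (by simp) (by simp)))) (by omega)
    | @all _ A hA =>
      simp only [PreFormula.size, refut] at *
      obtain ⟨a, ha⟩ := exists_freshFor (s :: Γ)
      have hs := A.size_inst_var a
      exact IntDer.mono (.exL a h₂ ha
        (.cutNeg (.imp (A.inst (.var a)) .falsum) (cN _ (by omega))
          (.impL' (X := .imp (.all A) .falsum) (by simp [h₁])
            (.impR (.allL_var a (.head _)
              (.negL (X := A.inst (.var a)) (by simp) (by simp)))))
          (R (A.inst (.var a)) (by omega) ((classes_inst _ A).2.1 hA) (by simp)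
            (by simp [refut_inst]))))
        (by omega)
    | @imp _ A B hA hB =>
      simp only [PreFormula.size, refut, PreFormula.liftTo] at *
      exact IntDer.mono (.andL h₂
        (.cutNeg (.imp B .falsum) (cN B (by omega))
          (.cutNeg A (cX A (by omega))
            (.impL' (X := .imp (.imp A B) .falsum) (by simp [h₁])
              (.impR (.impL (.head _) (.ax (by simp))
                (.negL (X := B) (by simp) (by simp)))))
            (J A (by omega) hA (by simp) (by simp)))
          (R B (by omega) hB (by simp) (by simp)))) (by omega)

/-! ### The translation of classical derivations -/

theorem Derivation.sequentSize_le {T : Set (Formula L)} {Γ Δ : List (Formula L)}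
    (d : Derivation T Γ Δ) : sequentSize (Γ, Δ) ≤ d.size := by
  cases d <;> simp [size, sequents]

set_option linter.unusedSimpArgs false in
/-- A classical derivation of `Γ ⇒ Δ`, with its free variables renamed, yields a derivation of `s`
from the translations of `Γ` and the refutations of `Δ`. -/
theorem Derivation.toIntDer {T : Set (Formula L)} (hT : ∀ A ∈ T, IsSentence A)
    (hQ : ∀ A ∈ T, ClassQ A) {M N : ℕ} {s : Formula L}
    (hM : ∀ A : Formula L, A.size ≤ N → (refut s A).size + A.size + 2 * s.size + 4 ≤ M)
    {Γ Δ : List (Formula L)} (d : Derivation T Γ Δ) (hN : d.size ≤ N) (σ : ℕ → ℕ)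
    (Θ : List (Formula L)) (hΓ : ∀ A ∈ Γ, .imp (refut s (A.rename σ)) s ∈ Θ)
    (hΔ : ∀ A ∈ Δ, refut s (A.rename σ) ∈ Θ) : IntDer T M (50 * d.size) Θ s := by
  have hR (σ : ℕ → ℕ) (A : Formula L) (hA : A.size ≤ N) :
      (PreFormula.imp (refut s (A.rename σ)) s).size ≤ M := by
    have := hM (A.rename σ) (by rwa [PreFormula.size_rename])
    simp only [PreFormula.size]; omega
  induction d generalizing σ Θ with
  | init A =>
    exact (IntDer.impL' (hΓ A (by simp)) (.ax (hΔ A (by simp)))).mono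
      (by simp [size, sequents, sequentSize]; omega)
  | falsum Γ Δ =>
    exact (IntDer.impL' (hΓ .falsum (by simp)) (.impR (.ax (.head _)))).mono
      (by simp [size, sequents, sequentSize]; omega)
  | theory Γ A h =>
    have hA : A.size < (theory Γ A h : Derivation T Γ [A]).size := by
      simp [size, sequents, sequentSize]
    have := hM A (by omega)
    -- The axiom itself is cut in; being in 𝒬, it clashes with its refutation.
    refine IntDer.mono (.cut A (by omega) (.theory h)
      ((classes_refut T M s N (fun B hB => by have := hM B hB; omega) A (by omega)
        (A :: Θ)).1 (hQ A h) (by simp) ?_)) (by omega)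
    have := hΔ A (by simp)
    rw [(hT A h).rename_eq] at this
    exact .tail _ this
  | weakL A d ih =>
    have hd := d.sequentSize_le
    simp only [size, sequents, sequentSize, List.map_cons, List.map_append, List.sum_cons,
      List.sum_append, List.map_nil, List.sum_nil] at hN hd ih ⊢
    exact (ih (by omega) σ Θ (fun B hB => hΓ B (by grind)) hΔ).mono (by omega)
  | weakR A d ih =>
    have hd := d.sequentSize_le
    simp only [size, sequents, sequentSize, List.map_cons, List.map_append, List.sum_cons,
      List.sum_append, List.map_nil, List.sum_nil] at hN hd ih ⊢
    exact (ih (by omega) σ Θ hΓ (fun B hB => hΔ B (by grind))).mono (by omega)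
  | contrL d ih =>
    have hd := d.sequentSize_le
    simp only [size, sequents, sequentSize, List.map_cons, List.map_append, List.sum_cons,
      List.sum_append, List.map_nil, List.sum_nil] at hN hd ih ⊢
    exact (ih (by omega) σ Θ (fun B hB => hΓ B (by grind)) hΔ).mono (by omega)
  | contrR d ih =>
    have hd := d.sequentSize_le
    simp only [size, sequents, sequentSize, List.map_cons, List.map_append, List.sum_cons,
      List.sum_append, List.map_nil, List.sum_nil] at hN hd ih ⊢
    exact (ih (by omega) σ Θ hΓ (fun B hB => hΔ B (by grind))).mono (by omega)
  | exchL d ih =>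
    have hd := d.sequentSize_le
    simp only [size, sequents, sequentSize, List.map_cons, List.map_append, List.sum_cons,
      List.sum_append, List.map_nil, List.sum_nil] at hN hd ih ⊢
    exact (ih (by omega) σ Θ (fun B hB => hΓ B (by grind)) hΔ).mono (by omega)
  | exchR d ih =>
    have hd := d.sequentSize_le
    simp only [size, sequents, sequentSize, List.map_cons, List.map_append, List.sum_cons,
      List.sum_append, List.map_nil, List.sum_nil] at hN hd ih ⊢
    exact (ih (by omega) σ Θ hΓ (fun B hB => hΔ B (by grind))).mono (by omega)
  | @cut Γ Ξ Δ Λ A d e ihd ihe =>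
    have hd := d.sequentSize_le
    have he := e.sequentSize_le
    simp only [size, sequents, sequentSize, List.map_cons, List.map_append, List.sum_cons,
      List.sum_append, List.map_nil, List.sum_nil] at hN hd he ihd ihe ⊢
    -- The left premise uses the refutation of the cut formula, the right premise its translation,
    -- so a cut becomes a case distinction.
    exact IntDer.mono (.cutNeg (refut s (A.rename σ)) (hR σ A (by omega))
      (ihd (by omega) σ _ (by grind) (by grind)) (ihe (by omega) σ _ (by grind) (by grind)))
      (by omega)
  | @andL₁ Γ Δ A B d ih =>
    have hd := d.sequentSize_le
    simp only [size, sequents, sequentSize, List.map_cons, List.map_append, List.sum_cons,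
      List.sum_append, List.map_nil, List.sum_nil] at hN hd ih ⊢
    have h := hΓ (.and A B) (by simp)
    simp only [PreFormula.rename, refut] at h
    exact IntDer.mono (.cutNeg (refut s (A.rename σ)) (hR σ A (by omega))
      (.impL' (.tail _ h) (.orR₁ (.ax (.head _))))
      (ih (by omega) σ _ (by grind) (by grind))) (by omega)
  | @andL₂ Γ Δ A B d ih =>
    have hd := d.sequentSize_le
    simp only [size, sequents, sequentSize, List.map_cons, List.map_append, List.sum_cons,
      List.sum_append, List.map_nil, List.sum_nil] at hN hd ih ⊢
    have h := hΓ (.and A B) (by simp)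
    simp only [PreFormula.rename, refut] at h
    exact IntDer.mono (.cutNeg (refut s (B.rename σ)) (hR σ B (by omega))
      (.impL' (.tail _ h) (.orR₂ (.ax (.head _))))
      (ih (by omega) σ _ (by grind) (by grind))) (by omega)
  | @andR Γ Δ A B d e ihd ihe =>
    have hd := d.sequentSize_le
    have he := e.sequentSize_le
    simp only [size, sequents, sequentSize, List.map_cons, List.map_append, List.sum_cons,
      List.sum_append, List.map_nil, List.sum_nil] at hN hd he ihd ihe ⊢
    have h := hΔ (.and A B) (by simp)
    simp only [PreFormula.rename, refut] at h
    exact IntDer.mono (.orL h (ihd (by omega) σ _ (by grind) (by grind))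
      (ihe (by omega) σ _ (by grind) (by grind))) (by omega)
  | @orL Γ Δ A B d e ihd ihe =>
    have hd := d.sequentSize_le
    have he := e.sequentSize_le
    simp only [size, sequents, sequentSize, List.map_cons, List.map_append, List.sum_cons,
      List.sum_append, List.map_nil, List.sum_nil] at hN hd he ihd ihe ⊢
    have h := hΓ (.or A B) (by simp)
    simp only [PreFormula.rename, refut] at h
    -- If both disjuncts are refuted, so is the disjunction; otherwise the translation of one of
    -- them is available and its premise applies.
    exact IntDer.mono (.cutNeg (refut s (A.rename σ)) (hR σ A (by omega))
      (.cutNeg (refut s (B.rename σ)) (hR σ B (by omega))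
        (.impL' (.tail _ (.tail _ h)) (.andR (.ax (by simp)) (.ax (by simp))))
        (ihe (by omega) σ _ (by grind) (by grind)))
      (ihd (by omega) σ _ (by grind) (by grind))) (by omega)
  | @orR₁ Γ Δ A B d ih =>
    have hd := d.sequentSize_le
    simp only [size, sequents, sequentSize, List.map_cons, List.map_append, List.sum_cons,
      List.sum_append, List.map_nil, List.sum_nil] at hN hd ih ⊢
    have h := hΔ (.or A B) (by simp)
    simp only [PreFormula.rename, refut] at h
    exact IntDer.mono (.andL h (ih (by omega) σ _ (by grind) (by grind))) (by omega)
  | @orR₂ Γ Δ A B d ih =>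
    have hd := d.sequentSize_le
    simp only [size, sequents, sequentSize, List.map_cons, List.map_append, List.sum_cons,
      List.sum_append, List.map_nil, List.sum_nil] at hN hd ih ⊢
    have h := hΔ (.or A B) (by simp)
    simp only [PreFormula.rename, refut] at h
    exact IntDer.mono (.andL h (ih (by omega) σ _ (by grind) (by grind))) (by omega)
  | @impL Γ Ξ Δ Λ A B d e ihd ihe =>
    have hd := d.sequentSize_le
    have he := e.sequentSize_le
    simp only [size, sequents, sequentSize, List.map_cons, List.map_append, List.sum_cons,
      List.sum_append, List.map_nil, List.sum_nil] at hN hd he ihd ihe ⊢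
    have h := hΓ (.imp A B) (by simp)
    simp only [PreFormula.rename, refut] at h
    exact IntDer.mono (.cutNeg (refut s (B.rename σ)) (hR σ B (by omega))
      (.impL' (.tail _ h) (.andR (.impR (ihd (by omega) σ _ (by grind) (by grind)))
        (.ax (.head _))))
      (ihe (by omega) σ _ (by grind) (by grind))) (by omega)
  | @impR Γ Δ A B d ih =>
    have hd := d.sequentSize_le
    simp only [size, sequents, sequentSize, List.map_cons, List.map_append, List.sum_cons,
      List.sum_append, List.map_nil, List.sum_nil] at hN hd ih ⊢
    have h := hΔ (.imp A B) (by simp)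
    simp only [PreFormula.rename, refut] at h
    exact IntDer.mono (.andL h (ih (by omega) σ _ (by grind [PreFormula.liftTo]) (by grind)))
      (by omega)
  | @allL Γ Δ A t d ih =>
    have hd := d.sequentSize_le
    simp only [size, sequents, sequentSize, List.map_cons, List.map_append, List.sum_cons,
      List.sum_append, List.map_nil, List.sum_nil] at hN hd ih ⊢
    have h := hΓ (.all A) (by simp)
    simp only [PreFormula.rename, refut] at h
    have ht : (refut s (A.rename σ)).inst (t.relabel σ) = refut s ((A.inst t).rename σ) := by
      rw [refut_inst, ← PreFormula.rename_inst]
    -- The size of `t` is not controlled by `A`, but `A.inst t` occurs in the premise and is thus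
    -- bounded by `N`.
    have hA := hR σ (A.inst t) (by omega)
    refine IntDer.mono (.cutNeg (refut s ((A.inst t).rename σ)) hA
      (.impL' (.tail _ h) (.exR (t.relabel σ) ?_ (.ax (ht ▸ .head _))))
      (ih (by omega) σ _ (by grind) (by grind))) (by omega)
    rw [ht]
    simp only [PreFormula.size] at hA
    omega
  | @allR Γ Δ A a fΓ fΔ fA d ih =>
    have hd := d.sequentSize_le
    simp only [size, sequents, sequentSize, List.map_cons, List.map_append, List.sum_cons,
      List.sum_append, List.map_nil, List.sum_nil] at hN hd ih ⊢
    have h := hΔ (.all A) (by simp)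
    simp only [PreFormula.rename, refut] at h
    -- The eigenvariable `a` may occur in `s` or `Θ`, so it is redirected to a fresh `b`.
    obtain ⟨b, hb⟩ := exists_freshFor (s :: Θ)
    have ht : (refut s (A.rename σ)).inst (.var b) =
        refut s ((A.inst (.var a)).rename (Function.update σ a b)) := by
      rw [refut_inst, rename_update_inst fA]
    refine IntDer.mono (.exL b h hb (ih (by omega) (Function.update σ a b) _ (fun B hB => ?_)
      fun B hB => ?_)) (by omega)
    · rw [rename_update_of_fresh fΓ σ b hB]
      exact .tail _ (hΓ B hB)
    · rcases List.mem_append.1 hB with hB | hB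
      · rw [rename_update_of_fresh fΔ σ b hB]
        exact .tail _ (hΔ B (by simp [hB]))
      · rw [List.mem_singleton.1 hB, ht]
        exact .head _
  | @exL Γ Δ A a fΓ fΔ fA d ih =>
    have hd := d.sequentSize_le
    simp only [size, sequents, sequentSize, List.map_cons, List.map_append, List.sum_cons,
      List.sum_append, List.map_nil, List.sum_nil] at hN hd ih ⊢
    have h := hΓ (.ex A) (by simp)
    simp only [PreFormula.rename, refut] at h
    obtain ⟨b, hb⟩ := exists_freshFor (refut s (.ex (A.rename σ)) :: Θ)
    have e := IntDer.impR (ih (by omega) (Function.update σ a b)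
      (.imp (refut s ((A.inst (.var a)).rename (Function.update σ a b))) s :: Θ)
      (fun B hB => ?_) fun B hB => ?_)
    · rw [rename_update_inst fA, ← doubleNeg_refut_inst] at e
      exact IntDer.mono (.impL' h (.allR b hb e)) (by omega)
    · rcases List.mem_cons.1 hB with rfl | hB
      · exact .head _
      · rw [rename_update_of_fresh fΓ σ b hB]
        exact .tail _ (hΓ B (by simp [hB]))
    · rw [rename_update_of_fresh fΔ σ b hB]
      exact .tail _ (hΔ B hB)
  | @exR Γ Δ A t d ih =>
    have hd := d.sequentSize_le
    simp only [size, sequents, sequentSize, List.map_cons, List.map_append, List.sum_cons,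
      List.sum_append, List.map_nil, List.sum_nil] at hN hd ih ⊢
    have h := hΔ (.ex A) (by simp)
    simp only [PreFormula.rename, refut] at h
    have hA := hM ((A.inst t).rename σ) (by rw [PreFormula.size_rename]; omega)
    have e := IntDer.impL' (.head _) (.impR (ih (by omega) σ
      (refut s ((A.inst t).rename σ) :: .imp (.imp (refut s ((A.inst t).rename σ)) s) s :: Θ)
      (by grind) (by grind)))
    rw [PreFormula.rename_inst, ← doubleNeg_refut_inst] at e
    refine IntDer.mono (.allL (t.relabel σ) h ?_ e) (by omega)
    rw [doubleNeg_refut_inst, ← PreFormula.rename_inst]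
    refine le_max_of_le_right ?_
    simp only [PreFormula.size]
    omega

-- Choice of the formula in the role of falsity

/-- A geometric implication is derivable if its refutation yields every formula `s` in the role of
falsity. -/
theorem IsGeometricImplication.intDer (T : Set (Formula L)) {M N : ℕ}
    (hM : ∀ s A : Formula L, s.size ≤ N → A.size ≤ N →
      (refut s A).size + A.size + 2 * s.size + 4 ≤ M) (k : ℕ) (hk : k ≤ N) :
    ∀ (A : Formula L), A.size ≤ k → IsGeometricImplication A → ∀ (n : ℕ) (Γ : List (Formula L)),
      (∀ s Θ, s.size ≤ N → Γ ⊆ Θ → refut s A ∈ Θ → IntDer T M n Θ s) →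
      IntDer T M (n + 50 * A.size) Γ A := by
  have hX {s A : Formula L} (hs : s.size ≤ N) (hA : A.size ≤ N) : (A.imp s).size ≤ M := by
    have := hM s A hs hA
    simp only [PreFormula.size]; omega
  have hR {s A : Formula L} (hs : s.size ≤ N) (hA : A.size ≤ N) :
      ((refut s A).imp s).size ≤ M := by
    have := hM s A hs hA
    simp only [PreFormula.size]; omega
  have key {B : Formula L} (hB : B.size ≤ N) {Γ : List (Formula L)} :=
    classes_refut T M B N (fun A hA => by have := hM B A hB hA; omega)
  -- Friedman's trick with `s = B`: the case `B` closes the goal at once, and the case of `B → B`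
  -- together with `refut B B → B` is the 𝒥 property.
  have hJ {n : ℕ} {B : Formula L} (hB : B.size ≤ N) (pB : IsPositive B) {Γ : List (Formula L)}
      (d : IntDer T M n (refut B B :: Γ) B) : IntDer T M (n + 40 * B.size + 5) Γ B :=
    .mono (.cutNeg (refut B B) (hR hB hB) d (.cutNeg B (hX hB hB) (.ax (.head _))
      ((key (Γ := Γ) hB B hB _).2.1 pB.classJ (by simp) (by simp)))) (by omega)
  induction k with
  | zero => exact fun A hA => absurd A.size_pos (by omega)
  | succ k ih =>
  intro A hA hG n Γ H
  cases hG with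
  | pos hp =>
    have := A.size_pos
    exact (hJ (by omega) hp (H A _ (by omega) (by simp) (by simp))).mono (by omega)
  | @imp _ A B pA pB =>
    have hAB := hM B (A.imp B)
    simp only [PreFormula.size, refut, PreFormula.liftTo] at hA hAB H ⊢
    have := A.size_pos
    -- With `s = B`, the 𝒬 property of `A` turns the assumption `A` into `refut B A → B`; with
    -- `refut B B` this is the refutation of `A → B`.
    exact IntDer.mono (.impR (hJ (B := B) (by omega) pB
      (.cut (.and (.imp (refut B A) B) (refut B B))
        (by simp only [PreFormula.size]; omega)
        (.andR (.impR ((key (Γ := Γ) (by omega) A (by omega) _).1 pA.classQ (by simp) (by simp)))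
          (.ax (.head _)))
        (H B _ (by omega) (fun x hx => by simp [hx]) (by simp))))) (by omega)
  | @all _ A hG =>
    obtain ⟨a, ha⟩ := exists_freshFor (.all A :: Γ)
    have hs := A.size_inst_var a
    have hAB (s : Formula L) := hM s (.all A)
    simp only [PreFormula.size, refut] at hA hAB H ⊢
    -- The `3` counts the cut, the `∃` introduction and its axiom, which turn a refutation of the
    -- instance into one of the universal formula.
    refine IntDer.mono (.allR a ha (ih (by omega) (A.inst (.var a)) (by omega) (hG.inst _) (n + 3) Γ
      fun s Θ hs hΓ hΘ => ?_)) (by omega)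
    have := hAB s hs (by omega)
    exact IntDer.mono (.cut (.ex (refut s A)) (by simp only [PreFormula.size]; omega)
      (.exR_var a (.ax (by rwa [refut_inst])))
      (H s _ hs (fun x hx => .tail _ (hΓ hx)) (.head _))) (by omega)

/-! ### From the cumulative calculus to intuitionistic derivations -/

/-- The total size of the formulas of a list. -/
def ctxSize (Γ : List (Formula L)) : ℕ := (Γ.map PreFormula.size).sum

@[simp] theorem ctxSize_nil : ctxSize ([] : List (Formula L)) = 0 := rfl

@[simp] theorem ctxSize_cons (A : Formula L) (Γ : List (Formula L)) :
    ctxSize (A :: Γ) = A.size + ctxSize Γ := by simp [ctxSize]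

@[simp] theorem ctxSize_append (Γ Θ : List (Formula L)) :
    ctxSize (Γ ++ Θ) = ctxSize Γ + ctxSize Θ := by simp [ctxSize]

theorem length_le_ctxSize (Γ : List (Formula L)) : Γ.length ≤ ctxSize Γ := by
  induction Γ with
  | nil => simp
  | cons A Γ ih =>
    have := A.size_pos
    simp only [List.length_cons, ctxSize_cons]; omega

/-- `IntDerivable T b Γ C`: the sequent `Γ ⇒ C` has an intuitionistic derivation of size at most
`b`. -/
def IntDerivable (T : Set (Formula L)) (b : ℕ) (Γ : List (Formula L)) (C : Formula L) : Prop :=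
  ∃ d : Derivation T Γ [C], d.IsIntuitionistic ∧ d.size ≤ b

namespace IntDerivable

variable {T : Set (Formula L)} {b b' S : ℕ} {Γ Θ : List (Formula L)} {A B C : Formula L}

theorem mono (h : IntDerivable T b Γ C) (hb : b ≤ b') : IntDerivable T b' Γ C :=
  let ⟨d, hd, h⟩ := h; ⟨d, hd, h.trans hb⟩

/-- Here and in `of_one` and `of_two`, a rule is an arbitrary function `f` with a prescribed list of
sequents; `S` bounds the size of the new end sequent, which is the cost of the rule. -/
theorem of_zero (d : Derivation T Γ [C]) (hd : d.sequents = [(Γ, [C])])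
    (hS : ctxSize Γ + C.size + 1 ≤ S) : IntDerivable T S Γ C :=
  ⟨d, by simp [Derivation.IsIntuitionistic, hd],
    by simp [Derivation.size, hd, sequentSize, ctxSize] at hS ⊢; omega⟩

theorem of_one {Γ' : List (Formula L)} {C' : Formula L} (h : IntDerivable T b Γ C)
    (f : Derivation T Γ [C] → Derivation T Γ' [C'])
    (hf : ∀ d, (f d).sequents = (Γ', [C']) :: d.sequents)
    (hS : ctxSize Γ' + C'.size + 1 ≤ S) : IntDerivable T (b + S) Γ' C' := by
  obtain ⟨d, hd, h⟩ := h
  refine ⟨f d, ?_, ?_⟩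
  · rw [Derivation.IsIntuitionistic, hf]
    exact List.forall_mem_cons.2 ⟨le_rfl, hd⟩
  · simp only [Derivation.size, hf, sequentSize, ctxSize, List.map_cons, List.sum_cons,
      List.map_nil, List.sum_nil] at hS h ⊢
    omega

theorem of_two {Γ₁ Γ₂ : List (Formula L)} {C₁ C₂ : Formula L} (h₁ : IntDerivable T b Γ₁ C₁)
    (h₂ : IntDerivable T b' Γ₂ C₂)
    (f : Derivation T Γ₁ [C₁] → Derivation T Γ₂ [C₂] → Derivation T Γ [C])
    (hf : ∀ d e, (f d e).sequents = (Γ, [C]) :: (d.sequents ++ e.sequents))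
    (hS : ctxSize Γ + C.size + 1 ≤ S) : IntDerivable T (b + b' + S) Γ C := by
  obtain ⟨d, hd, h⟩ := h₁
  obtain ⟨e, he, h'⟩ := h₂
  refine ⟨f d e, ?_, ?_⟩
  · rw [Derivation.IsIntuitionistic, hf]
    exact List.forall_mem_cons.2 ⟨le_rfl, List.forall_mem_append.2 ⟨hd, he⟩⟩
  · simp only [Derivation.size, hf, sequentSize, ctxSize, List.map_cons, List.sum_cons,
      List.map_nil, List.sum_nil, List.map_append, List.sum_append] at hS h h' ⊢
    omega

theorem weakL (h : IntDerivable T b Γ C) (hS : ctxSize (A :: Γ) + C.size + 1 ≤ S) :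
    IntDerivable T (b + S) (A :: Γ) C :=
  h.of_one (.weakL A) (fun _ => rfl) hS

theorem contrL (h : IntDerivable T b (A :: A :: Γ) C) (hS : ctxSize (A :: Γ) + C.size + 1 ≤ S) :
    IntDerivable T (b + S) (A :: Γ) C :=
  h.of_one .contrL (fun _ => rfl) hS

theorem exchL (h : IntDerivable T b (Γ ++ A :: B :: Θ) C)
    (hS : ctxSize (Γ ++ B :: A :: Θ) + C.size + 1 ≤ S) :
    IntDerivable T (b + S) (Γ ++ B :: A :: Θ) C :=
  h.of_one .exchL (fun _ => rfl) hS

theorem moveLeft (Δ : List (Formula L)) (Γ : List (Formula L))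
    (h : IntDerivable T b (Γ ++ (Δ ++ A :: Θ)) C)
    (hS : ctxSize (Γ ++ A :: (Δ ++ Θ)) + C.size + 1 ≤ S) :
    IntDerivable T (b + Δ.length * S) (Γ ++ A :: (Δ ++ Θ)) C := by
  induction Δ generalizing Γ with
  | nil => simpa using h
  | cons B Δ ih =>
    have h' := ih (Γ ++ [B]) (by simpa using h) (by simp at hS ⊢; omega)
    rw [List.append_assoc] at h'
    exact (exchL (S := S) h' (by simpa using hS)).mono
      (by simp only [List.length_cons, add_mul]; omega)

theorem moveRight (Δ : List (Formula L)) (Γ : List (Formula L))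
    (h : IntDerivable T b (Γ ++ A :: (Δ ++ Θ)) C)
    (hS : ctxSize (Γ ++ A :: (Δ ++ Θ)) + C.size + 1 ≤ S) :
    IntDerivable T (b + Δ.length * S) (Γ ++ (Δ ++ A :: Θ)) C := by
  induction Δ generalizing Γ b with
  | nil => simpa using h
  | cons B Δ ih =>
    have h' := exchL (S := S) (Θ := Δ ++ Θ) (B := B) h (by simp at hS ⊢; omega)
    have h'' := ih (b := b + S) (Γ ++ [B]) (by simpa using h') (by simp at hS ⊢; omega)
    rw [List.append_assoc] at h''
    exact h''.mono (by simp only [List.length_cons, add_mul]; omega)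

/-- The extra `A` is moved across `Θ` to the front, its copy in `Θ` is moved next to it, both are
contracted, and the result is moved back: at most `3 * Θ.length + 1` rules. -/
theorem absorb (h : IntDerivable T b (Θ ++ A :: Γ) C) (hA : A ∈ Θ)
    (hS : ctxSize (Θ ++ A :: Γ) + C.size + 1 ≤ S) :
    IntDerivable T (b + (3 * Θ.length + 1) * S) (Θ ++ Γ) C := by
  obtain ⟨P, Q, rfl⟩ := List.append_of_mem hA
  have h₁ := moveLeft (S := S) (P ++ A :: Q) [] h (by simp at hS ⊢; omega)
  have h₂ := moveLeft (S := S) (A := A) (Θ := Q ++ Γ) P [A] (by simpa using h₁)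
    (by simp at hS ⊢; omega)
  have h₃ := contrL (S := S) h₂ (by simp at hS ⊢; omega)
  have h₄ := moveRight (S := S) (A := A) (Θ := Q ++ Γ) P [] h₃ (by simp at hS ⊢; omega)
  simp only [List.nil_append, List.append_assoc, List.cons_append] at h₄ ⊢
  refine h₄.mono ?_
  simp only [List.length_append, List.length_cons]
  nlinarith [Nat.zero_le (Q.length * S)]

theorem absorb_list (Γ : List (Formula L)) (h : IntDerivable T b (Θ ++ Γ) C) (hΓ : Γ ⊆ Θ)
    (hS : ctxSize (Θ ++ Γ) + C.size + 1 ≤ S) :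
    IntDerivable T (b + Γ.length * ((3 * Θ.length + 1) * S)) Θ C := by
  induction Γ generalizing b with
  | nil => simpa using h
  | cons A Γ ih =>
    refine (ih (h.absorb (hΓ (.head _)) hS) (fun x hx => hΓ (.tail _ hx))
      (by simp at hS ⊢; omega)).mono ?_
    generalize (3 * Θ.length + 1) * S = x
    rw [List.length_cons, Nat.add_one_mul]
    omega

theorem weakL_list (Θ : List (Formula L)) (h : IntDerivable T b Γ C)
    (hS : ctxSize (Θ ++ Γ) + C.size + 1 ≤ S) :
    IntDerivable T (b + Θ.length * S) (Θ ++ Γ) C := by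
  induction Θ with
  | nil => simpa using h
  | cons A Θ ih =>
    exact ((ih (by simp at hS ⊢; omega)).weakL (S := S) hS).mono
      (by simp only [List.length_cons, add_mul]; omega)

/-- Weakening, contraction and exchange combined. -/
theorem of_subset (h : IntDerivable T b Γ C) (hΓ : Γ ⊆ Θ)
    (hS : ctxSize Θ + ctxSize Γ + C.size + 1 ≤ S) : IntDerivable T (b + 5 * S ^ 3) Θ C := by
  rw [← ctxSize_append] at hS
  refine ((h.weakL_list Θ hS).absorb_list Γ hΓ hS).mono ?_
  have h₁ := length_le_ctxSize Γ
  have h₂ := length_le_ctxSize Θ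
  rw [ctxSize_append] at hS
  calc b + Θ.length * S + Γ.length * ((3 * Θ.length + 1) * S)
      ≤ b + S * S + S * ((3 * S + S) * S) := by gcongr <;> omega
    _ = b + S ^ 2 + 4 * S ^ 3 := by ring
    _ ≤ b + S ^ 3 + 4 * S ^ 3 := by gcongr <;> omega
    _ = b + 5 * S ^ 3 := by ring

end IntDerivable

-- Simulation of the cumulative calculus

theorem size_le_ctxSize {A : Formula L} {Γ : List (Formula L)} (h : A ∈ Γ) :
    A.size ≤ ctxSize Γ :=
  List.single_le_sum (by simp) _ (List.mem_map_of_mem h)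

/-- The cumulative calculus is simulated by intuitionistic derivations of polynomial size. -/
theorem IntDer.intDerivable {T : Set (Formula L)} {M W n : ℕ} {Γ : List (Formula L)}
    {C : Formula L} (d : IntDer T M n Γ C) (hΓ : ∀ A ∈ Γ, A.size ≤ M) (hC : C.size ≤ M)
    (hW : ctxSize Γ + n * M + M + 1 ≤ W) :
    IntDerivable T (n * (5 * (4 * W) ^ 3 + 16 * W)) Γ C := by
  -- The cubic cost of `of_subset` is made opaque, so that the accounting is linear. The bound `4 *
  -- W` leaves room for a target context next to a duplicated one.
  generalize hK : 5 * (4 * W) ^ 3 = K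
  have sub {b : ℕ} {Γ Θ : List (Formula L)} {C : Formula L} (h : IntDerivable T b Γ C)
      (hΓ : Γ ⊆ Θ) (hS : ctxSize Θ + ctxSize Γ + C.size + 1 ≤ 4 * W) :
      IntDerivable T (b + K) Θ C := hK ▸ h.of_subset hΓ hS
  clear hK
  induction d with
  | mono d h ih =>
    have := Nat.mul_le_mul_right M h
    exact (ih hΓ hC (by omega)).mono (Nat.mul_le_mul_right _ h)
  | @ax Γ C h =>
    have h' : IntDerivable T W [C] C := .of_zero (.init C) rfl (by simp; omega)
    exact (sub h' (by simpa using h) (by simp; omega)).mono (by omega)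
  | @theory Γ A h =>
    have h' : IntDerivable T W Γ A := .of_zero (.theory Γ A h) rfl (by omega)
    exact h'.mono (by omega)
  | @falsum Γ C h =>
    have := size_le_ctxSize h
    have h' : IntDerivable T W [.falsum] C := .of_zero (.falsum [] [C]) rfl (by simp; omega)
    exact (sub h' (by simpa using h) (by simp; omega)).mono (by omega)
  | @cut m n Γ C A hA d e ihd ihe =>
    simp only [add_mul, one_mul, List.forall_mem_cons, ctxSize_cons] at hW ihd ihe ⊢
    -- The cut of LK concatenates the two contexts; `sub` contracts `Γ ++ Γ` back to `Γ`.
    have h := (ihd hΓ hA (by omega)).of_two (S := 4 * W) (ihe ⟨hA, hΓ⟩ hC (by omega))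
      (.cut (Δ := [])) (fun _ _ => rfl) (by simp; omega)
    exact (sub h (by simp) (by simp; omega)).mono (by omega)
  | @andL n Γ A B C h d ih =>
    have hAB := hΓ _ h
    have hs := size_le_ctxSize h
    simp only [PreFormula.size] at hAB hs
    simp only [add_mul, one_mul, List.forall_mem_cons, ctxSize_cons] at hW ih ⊢
    -- The rules of LK treat one conjunct at a time, producing two copies of the conjunction besides
    -- the one in `Γ`; `sub` removes both.
    have h₁ := (ih ⟨by omega, by omega, hΓ⟩ hC (by omega)).of_one (S := 4 * W)
      (.andL₁ B) (fun _ => rfl) (by simp [PreFormula.size]; omega)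
    have h₂ := (h₁.exchL (Γ := []) (S := 4 * W) (by simp [PreFormula.size]; omega)).of_one
      (S := 4 * W) (.andL₂ A) (fun _ => rfl) (by simp [PreFormula.size]; omega)
    exact (sub h₂ (by simp [h]) (by simp [PreFormula.size]; omega)).mono (by omega)
  | @andR m n Γ A B d e ihd ihe =>
    simp only [PreFormula.size] at hC
    simp only [add_mul, one_mul] at hW ⊢
    have h := (ihd hΓ (by omega) (by omega)).of_two (S := W) (ihe hΓ (by omega) (by omega))
      (.andR (Δ := [])) (fun _ _ => rfl) (by simp [PreFormula.size]; omega)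
    exact h.mono (by omega)
  | @orL m n Γ A B C h d e ihd ihe =>
    have hAB := hΓ _ h
    simp only [PreFormula.size] at hAB
    simp only [add_mul, one_mul, List.forall_mem_cons, ctxSize_cons] at hW ihd ihe ⊢
    have h' := (ihd ⟨by omega, hΓ⟩ hC (by omega)).of_two (S := 4 * W)
      (ihe ⟨by omega, hΓ⟩ hC (by omega)) .orL (fun _ _ => rfl) (by simp [PreFormula.size]; omega)
    exact (sub h' (by simp [h]) (by simp [PreFormula.size]; omega)).mono (by omega)
  | @orR₁ n Γ A B d ih =>
    simp only [PreFormula.size] at hC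
    simp only [add_mul, one_mul] at hW ⊢
    have h := (ih hΓ (by omega) (by omega)).of_one (S := W) (.orR₁ (Δ := []) B) (fun _ => rfl)
      (by simp [PreFormula.size]; omega)
    exact h.mono (by omega)
  | @orR₂ n Γ A B d ih =>
    simp only [PreFormula.size] at hC
    simp only [add_mul, one_mul] at hW ⊢
    have h := (ih hΓ (by omega) (by omega)).of_one (S := W) (.orR₂ (Δ := []) A) (fun _ => rfl)
      (by simp [PreFormula.size]; omega)
    exact h.mono (by omega)
  | @impL m n Γ A B C h d e ihd ihe =>
    have hAB := hΓ _ h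
    simp only [PreFormula.size] at hAB
    simp only [add_mul, one_mul, List.forall_mem_cons, ctxSize_cons] at hW ihd ihe ⊢
    have h' := (ihd hΓ (by omega) (by omega)).of_two (S := 4 * W)
      (ihe ⟨by omega, hΓ⟩ hC (by omega)) (.impL (Δ := [])) (fun _ _ => rfl)
      (by simp [PreFormula.size]; omega)
    exact (sub h' (by simp [h]) (by simp [PreFormula.size]; omega)).mono (by omega)
  | @impR n Γ A B d ih =>
    simp only [PreFormula.size] at hC
    simp only [add_mul, one_mul, List.forall_mem_cons, ctxSize_cons] at hW ih ⊢
    have h := (ih ⟨by omega, hΓ⟩ (by omega) (by omega)).of_one (S := W) (.impR (Δ := []))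
      (fun _ => rfl) (by simp [PreFormula.size]; omega)
    exact h.mono (by omega)
  | @allL n Γ A C t h ht d ih =>
    have hA := hΓ _ h
    simp only [PreFormula.size] at hA
    simp only [add_mul, one_mul, List.forall_mem_cons, ctxSize_cons] at hW ih ⊢
    have h' := (ih ⟨by omega, hΓ⟩ hC (by omega)).of_one (S := 4 * W) (.allL t) (fun _ => rfl)
      (by simp [PreFormula.size]; omega)
    exact (sub h' (by simp [h]) (by simp [PreFormula.size]; omega)).mono (by omega)
  | @allR n Γ A a ha d ih =>
    have hs := A.size_inst_var a
    simp only [PreFormula.size] at hC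
    simp only [add_mul, one_mul] at hW ⊢
    have h := (ih hΓ (by omega) (by omega)).of_one (S := W)
      (.allR (Δ := []) a (fun B hB => ha B (.tail _ hB)) nofun (ha _ (.head _))) (fun _ => rfl)
      (by simp [PreFormula.size]; omega)
    exact h.mono (by omega)
  | @exL n Γ A C a h ha d ih =>
    have hs := A.size_inst_var a
    have hA := hΓ _ h
    simp only [PreFormula.size] at hA
    simp only [add_mul, one_mul, List.forall_mem_cons, ctxSize_cons] at hW ih ⊢
    have h' := (ih ⟨by omega, hΓ⟩ hC (by omega)).of_one (S := 4 * W)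
      (.exL a (fun B hB => ha B (.tail _ hB))
        (fun B hB => ha B (by simp at hB; simp [hB])) (ha _ (.tail _ h))) (fun _ => rfl)
      (by simp [PreFormula.size]; omega)
    exact (sub h' (by simp [h]) (by simp [PreFormula.size]; omega)).mono (by omega)
  | @exR n Γ A t ht d ih =>
    simp only [PreFormula.size] at hC
    simp only [add_mul, one_mul] at hW ⊢
    have h := (ih hΓ (by omega) (by omega)).of_one (S := W) (.exR (Δ := []) t) (fun _ => rfl)
      (by simp [PreFormula.size]; omega)
    exact h.mono (by omega)

/-- A classical derivation of a geometric implication yields an intuitionistic derivation whose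
size is bounded explicitly in terms of the size of the given one. -/
theorem Derivation.exists_isIntuitionistic {T : Set (Formula L)} (hT : ∀ A ∈ T, IsSentence A)
    (hQ : ∀ A ∈ T, ClassQ A) {C : Formula L} (hC : IsGeometricImplication C)
    (d : Derivation T [] [C]) {N M W : ℕ} (hN : d.size = N)
    (hM : M = (2 * N + 4) * N + 3 * N + 4) (hW : W = 100 * N * M + M + 1) :
    IntDerivable T (100 * N * (5 * (4 * W) ^ 3 + 16 * W)) [] C := by
  have hCN := d.sequentSize_le
  simp only [sequentSize, List.map_nil, List.map_cons, List.sum_cons, List.sum_nil] at hCN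
  have hM' (s A : Formula L) (hs : s.size ≤ N) (hA : A.size ≤ N) :
      (refut s A).size + A.size + 2 * s.size + 4 ≤ M := by
    have h₁ := size_refut_le s A
    have h₂ : (2 * s.size + 4) * A.size ≤ (2 * N + 4) * N := by gcongr
    omega
  -- The translation takes `50 * d.size` steps and the extraction `50 * C.size`, together at most
  -- `100 * N`.
  have h := hC.intDer T hM' C.size (by omega) C le_rfl (50 * d.size) [] fun s Θ hs _ hΘ =>
    d.toIntDer hT hQ (fun A hA => hM' s A hs hA) hN.le id Θ nofun
      (by simpa [PreFormula.rename_id] using hΘ)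
  exact IntDer.intDerivable (h.mono (by omega)) nofun
    (by have := hM' C C (by omega) (by omega); omega) (by simp [hW])

end GeomLogic

theorem mainTheorem2 :
    ∃ p : Polynomial ℕ, ∀ (L : FirstOrder.Language.{u, v}) (T : Set (GeomLogic.Formula L)),
      (∀ A ∈ T, GeomLogic.IsSentence A) → (∀ A ∈ T, GeomLogic.ClassQ A) →
      ∀ φ : GeomLogic.Formula L, GeomLogic.IsGeometricImplication φ →
        (GeomLogic.ProvesClassically T φ → GeomLogic.ProvesIntuitionistically T φ) ∧
        ∀ D : GeomLogic.Derivation T [] [φ], ∃ D' : GeomLogic.Derivation T [] [φ],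
          D'.IsIntuitionistic ∧ D'.size ≤ p.eval D.size := by
  -- These are the bounds of `Derivation.exists_isIntuitionistic` with the variable in place of `N`;
  -- the resulting polynomial has degree 10.
  let M : Polynomial ℕ := (2 * .X + 4) * .X + 3 * .X + 4
  let W : Polynomial ℕ := 100 * .X * M + M + 1
  refine ⟨100 * .X * (5 * (4 * W) ^ 3 + 16 * W), fun L T hT hQ φ hφ => ?_⟩
  have key (D : GeomLogic.Derivation T [] [φ]) := D.exists_isIntuitionistic hT hQ hφ rfl rfl rfl
  refine ⟨fun ⟨D⟩ => ?_, fun D => ?_⟩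
  · obtain ⟨D', h, -⟩ := key D
    exact ⟨D', h⟩
  · obtain ⟨D', h, hD⟩ := key D
    refine ⟨D', h, hD.trans_eq ?_⟩
    simp [M, W]
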